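/- Fix a scalar field $\mathbb{K}\in\{\mathbb{R},\mathbb{C}\}$; all spaces are Banach spaces over $\mathbb{K}$. A space $Y$ is finitely representable in $Z$ if for every $\varepsilon>0$ and every finite-dimensional subspace $A\subseteq Y$ there are a subspace $B\subseteq Z$ and an isomorphism $u:A\to B$ with $\|u\|\,\|u^{-1}\|\le 1+\varepsilon$. For a Banach space $X$ let $X^f$ be the class of all Banach spaces $Z$ such that $X$ is finitely representable in $Z$ and $Z$ is finitely representable in $X$. A norm-one projection of a space $F$ onto a subspace $S$ is a linear map $P:F\to F$ with values in $S$, $P|_S=\mathrm{id}_S$ and $\|P\|\le 1$ (so $\|P\|=1$ unless $S=0$). A Banach space $E$ is called - universally complemented in $X^f$, if for every $Z\in X^f$ and every isometric linear embedding $i:E\to Z$ there is a norm-one projection of $Z$ onto $i(E)$; - algebraically closed in $X^f$, if for every $Z\in X^f$ and every isometric linear embedding $i:E\to Z$ there is a norm-one projection of $Z^{**}$ onto $i^{**}(E^{**})$; - quasi-dual, if there is a norm-one projection of $E^{**}$ onto the canonical image of $E$ in $E^{**}$. Let $X$ and $E$ be Banach spaces. 1. If $E$ is finitely representable in $X$,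 then $E$ is universally complemented in $X^f$ if and only if $E$ is algebraically closed in $X^f$ and quasi-dual. (That is, $\mathfrak{P}_1(X^f)=\mathcal{A}(X^f)\cap\mathfrak{qd}$, where these classes are taken among the spaces finitely representable in $X$.) 2. $E$ is universally complemented in $X^f$ if and only if for every $Z\in X^f$, every isometric linear embedding $i:E\to Z$, every Banach space $W$ and every bounded operator $T:E\to W$ there is a bounded operator $V:Z\to W$ with $V\circ i=T$ and $\|V\|=\|T\|$. -/

import Mathlib

universe u

/-- `P` is a norm one projection of the normed space `F` onto its subspace `S`: `P` takes values
in `S`, is the identity on `S`, and is a contraction. If `S ≠ 0`, the norm of `P` is then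
exactly `1` (see `IsNormOneProjectionOnto.norm_eq_one`); the zero projection onto `S = 0` is
admitted. -/
structure IsNormOneProjectionOnto {𝕜 : Type} [RCLike 𝕜] {F : Type u} [NormedAddCommGroup F]
    [NormedSpace 𝕜 F] (P : F →L[𝕜] F) (S : Submodule 𝕜 F) : Prop where
  mem : ∀ x : F, P x ∈ S
  eq_self : ∀ x ∈ S, P x = x
  norm_le : ‖P‖ ≤ 1

theorem IsNormOneProjectionOnto.norm_eq_one {𝕜 : Type} [RCLike 𝕜] {F : Type u}
    [NormedAddCommGroup F] [NormedSpace 𝕜 F] {P : F →L[𝕜] F} {S : Submodule 𝕜 F}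
    (h : IsNormOneProjectionOnto P S) (hS : S ≠ ⊥) : ‖P‖ = 1 := by
  obtain ⟨x, hxS, hx⟩ := Submodule.exists_mem_ne_zero_of_ne_bot hS
  refine le_antisymm h.norm_le ?_
  have h1 := P.le_opNorm x
  rw [h.eq_self x hxS] at h1
  have h2 : 0 < ‖x‖ := norm_pos_iff.mpr hx
  nlinarith

/-- The double adjoint `T** : E** → F**` of a bounded operator `T : E → F`. -/
noncomputable def doubleAdjoint {𝕜 : Type} [RCLike 𝕜] {E F : Type u}
    [NormedAddCommGroup E] [NormedSpace 𝕜 E] [NormedAddCommGroup F] [NormedSpace 𝕜 F]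
    (T : E →L[𝕜] F) :
    StrongDual 𝕜 (StrongDual 𝕜 E) →L[𝕜] StrongDual 𝕜 (StrongDual 𝕜 F) :=
  ContinuousLinearMap.precomp 𝕜 (ContinuousLinearMap.precomp 𝕜 T)

theorem doubleAdjoint_apply {𝕜 : Type} [RCLike 𝕜] {E F : Type u}
    [NormedAddCommGroup E] [NormedSpace 𝕜 E] [NormedAddCommGroup F] [NormedSpace 𝕜 F]
    (T : E →L[𝕜] F) (φ : StrongDual 𝕜 (StrongDual 𝕜 E)) (f : StrongDual 𝕜 F) :
    doubleAdjoint T φ f = φ (f.comp T) := rfl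

/-- `X` is finitely representable in `Y`. -/
def FinitelyRepresentable (𝕜 : Type) [RCLike 𝕜] (X Y : Type u)
    [NormedAddCommGroup X] [NormedSpace 𝕜 X] [NormedAddCommGroup Y] [NormedSpace 𝕜 Y] : Prop :=
  ∀ ε : ℝ, 0 < ε → ∀ A : Submodule 𝕜 X, FiniteDimensional 𝕜 A →
    ∃ (B : Submodule 𝕜 Y) (v : A ≃L[𝕜] B),
      ‖(v : A →L[𝕜] B)‖ * ‖(v.symm : B →L[𝕜] A)‖ ≤ 1 + ε

/-- `X` and `Y` are finitely equivalent, i.e. `Y` belongs to the class `X^f`. -/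
def FinitelyEquivalent (𝕜 : Type) [RCLike 𝕜] (X Y : Type u)
    [NormedAddCommGroup X] [NormedSpace 𝕜 X] [NormedAddCommGroup Y] [NormedSpace 𝕜 Y] : Prop :=
  FinitelyRepresentable 𝕜 X Y ∧ FinitelyRepresentable 𝕜 Y X

/-- `E` is algebraically closed in the class `X^f`: for every isometric embedding `i` of `E` into
a Banach space `Z` of this class, there is a norm one projection of `Z**` onto `i**(E**)`. -/
def AlgebraicallyClosedIn (𝕜 : Type) [RCLike 𝕜] (X E : Type u)
    [NormedAddCommGroup X] [NormedSpace 𝕜 X] [NormedAddCommGroup E] [NormedSpace 𝕜 E] : Prop :=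
  ∀ (Z : Type u) [NormedAddCommGroup Z] [NormedSpace 𝕜 Z] [CompleteSpace Z],
    FinitelyEquivalent 𝕜 X Z → ∀ i : E →ₗᵢ[𝕜] Z,
      ∃ P : StrongDual 𝕜 (StrongDual 𝕜 Z) →L[𝕜] StrongDual 𝕜 (StrongDual 𝕜 Z),
        IsNormOneProjectionOnto (𝕜 := 𝕜) (F := StrongDual 𝕜 (StrongDual 𝕜 Z)) P
          (LinearMap.range (doubleAdjoint i.toContinuousLinearMap).toLinearMap)

/-- `E` is universally complemented in the class `X^f`: for every isometric embedding `i` of `E`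
into a Banach space `Z` of this class, there is a norm one projection of `Z` onto `i(E)`. -/
def UniversallyComplementedIn (𝕜 : Type) [RCLike 𝕜] (X E : Type u)
    [NormedAddCommGroup X] [NormedSpace 𝕜 X] [NormedAddCommGroup E] [NormedSpace 𝕜 E] : Prop :=
  ∀ (Z : Type u) [NormedAddCommGroup Z] [NormedSpace 𝕜 Z] [CompleteSpace Z],
    FinitelyEquivalent 𝕜 X Z → ∀ i : E →ₗᵢ[𝕜] Z,
      ∃ P : Z →L[𝕜] Z, IsNormOneProjectionOnto P (LinearMap.range i.toLinearMap)

/-- `E` is quasi-dual: there is a norm one projection of `E**` onto the canonical image of `E`. -/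
def QuasiDual (𝕜 : Type) [RCLike 𝕜] (E : Type u)
    [NormedAddCommGroup E] [NormedSpace 𝕜 E] : Prop :=
  ∃ P : StrongDual 𝕜 (StrongDual 𝕜 E) →L[𝕜] StrongDual 𝕜 (StrongDual 𝕜 E),
    IsNormOneProjectionOnto (𝕜 := 𝕜) (F := StrongDual 𝕜 (StrongDual 𝕜 E)) P
      (LinearMap.range (NormedSpace.inclusionInDoubleDual 𝕜 E).toLinearMap)

/-- Every bounded operator from `E` to a Banach space `W` extends, with the same norm, to every
Banach space `Z` of the class `X^f` that contains `E` isometrically. -/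
def ExtensionPropertyIn (𝕜 : Type) [RCLike 𝕜] (X E : Type u)
    [NormedAddCommGroup X] [NormedSpace 𝕜 X] [NormedAddCommGroup E] [NormedSpace 𝕜 E] : Prop :=
  ∀ (Z : Type u) [NormedAddCommGroup Z] [NormedSpace 𝕜 Z] [CompleteSpace Z],
    FinitelyEquivalent 𝕜 X Z → ∀ i : E →ₗᵢ[𝕜] Z,
      ∀ (W : Type u) [NormedAddCommGroup W] [NormedSpace 𝕜 W] [CompleteSpace W]
        (T : E →L[𝕜] W),
        ∃ V : Z →L[𝕜] W, (∀ x : E, V (i x) = T x) ∧ ‖V‖ = ‖T‖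

/-! A norm-one projection onto `i(E)` amounts to a contractive left inverse of `i`. With this, most
implications are compositions: `T` extends through the left inverse, taking `T = id` recovers it,
its second adjoint handles biduals, and conversely `Z → Z** → E** → E` is a left inverse.

The substantial point is that universal complementation forces quasi-duality. The bidual `E**` need
not lie in `X^f`, but an ultrapower of `X` does, so it suffices to map `E**` into one by a linear
contraction `S` isometric on `E`; if `p` is a left inverse of `S` on `E`, then `p ∘ S` projects
`E**` onto `E`. As `S` need not be isometric on `E**`, a Helly-type form of local reflexivity with
only upper norm estimates is enough (`exists_finsupp_approx_bidual`);
`exists_contraction_bidual_ultrapower` assembles `S` from it. -/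

open Filter Topology Finsupp
open scoped ENNReal

/-! ### Almost isometric maps on finite-dimensional subspaces -/

section FiniteRepresentability

variable {𝕜 : Type} [RCLike 𝕜] {X Y : Type u}
  [NormedAddCommGroup X] [NormedSpace 𝕜 X] [NormedAddCommGroup Y] [NormedSpace 𝕜 Y]

/-- A finite-dimensional subspace of a space finitely representable in `Y` is mapped to `Y` by a
linear contraction that is almost isometric on it. -/
theorem FinitelyRepresentable.exists_linearMap (h : FinitelyRepresentable 𝕜 X Y) {ε : ℝ}
    (hε : 0 < ε) (A : Submodule 𝕜 X) [FiniteDimensional 𝕜 A] :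
    ∃ v : X →ₗ[𝕜] Y, ∀ x ∈ A, ‖v x‖ ≤ ‖x‖ ∧ ‖x‖ ≤ (1 + ε) * ‖v x‖ := by
  obtain ⟨B, v, hv⟩ := h ε hε A inferInstance
  set c : ℝ := ‖(v : A →L[𝕜] B)‖ with hc
  obtain ⟨w, hw⟩ := LinearMap.exists_extend
    ((((c⁻¹ : ℝ) : 𝕜)) • (B.subtype ∘ₗ ((v : A →L[𝕜] B) : A →ₗ[𝕜] B)))
  refine ⟨w, fun x hx => ?_⟩
  have hwx : ‖w x‖ = c⁻¹ * ‖v ⟨x, hx⟩‖ := by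
    have h1 := LinearMap.congr_fun hw ⟨x, hx⟩
    simp only [LinearMap.comp_apply, Submodule.subtype_apply, LinearMap.smul_apply] at h1
    rw [h1, norm_smul, RCLike.norm_ofReal, abs_of_nonneg (inv_nonneg.2 (norm_nonneg _))]
    rfl
  have h1 : ‖v ⟨x, hx⟩‖ ≤ c * ‖x‖ := (v : A →L[𝕜] B).le_opNorm ⟨x, hx⟩
  have h2 : ‖x‖ ≤ ‖(v.symm : B →L[𝕜] A)‖ * ‖v ⟨x, hx⟩‖ := by
    have := (v.symm : B →L[𝕜] A).le_opNorm (v ⟨x, hx⟩)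
    simpa using this
  rw [hwx]
  -- If `c = 0`, then `A = 0` and `c⁻¹` has the default value `0`.
  rcases (norm_nonneg (v : A →L[𝕜] B)).eq_or_lt with h0 | h0
  · rw [← hc] at h0
    have h3 : ‖v ⟨x, hx⟩‖ = 0 := le_antisymm (by simpa [← h0] using h1) (norm_nonneg _)
    rw [h3] at h2 ⊢
    exact ⟨by simp, by simpa using h2⟩
  · rw [← hc] at h0
    refine ⟨by rw [inv_mul_le_iff₀ h0]; exact h1, h2.trans ?_⟩
    rw [← mul_assoc]
    refine mul_le_mul_of_nonneg_right ?_ (norm_nonneg _)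
    rw [← div_eq_mul_inv, le_div_iff₀ h0, mul_comm]
    exact hv

theorem FinitelyRepresentable.of_exists_linearMap
    (h : ∀ ε : ℝ, 0 < ε → ∀ A : Submodule 𝕜 X, FiniteDimensional 𝕜 A →
      ∃ v : A →ₗ[𝕜] Y, ∀ x, ‖v x‖ ≤ (1 + ε) * ‖x‖ ∧ ‖x‖ ≤ (1 + ε) * ‖v x‖) :
    FinitelyRepresentable 𝕜 X Y := by
  intro ε hε A hA
  -- For `δ ≤ 1`, `(1 + δ)² ≤ 1 + 3δ`.
  set δ : ℝ := min 1 (ε / 3) with hδ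
  have hδ0 : 0 < δ := lt_min one_pos (by positivity)
  have hδ1 : δ ≤ 1 := min_le_left _ _
  have hδ2 : δ ≤ ε / 3 := min_le_right _ _
  obtain ⟨v, hv⟩ := h δ hδ0 A hA
  have hinj : Function.Injective v := by
    rw [← LinearMap.ker_eq_bot, LinearMap.ker_eq_bot']
    intro x hx
    have := (hv x).2
    rw [hx, norm_zero, mul_zero] at this
    exact norm_le_zero_iff.1 this
  let e : A ≃L[𝕜] LinearMap.range v := (LinearEquiv.ofInjective v hinj).toContinuousLinearEquiv
  have he : ∀ x, ‖e x‖ = ‖v x‖ := fun x => rfl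
  refine ⟨LinearMap.range v, e, ?_⟩
  have h1 : ‖(e : A →L[𝕜] LinearMap.range v)‖ ≤ 1 + δ :=
    ContinuousLinearMap.opNorm_le_bound _ (by positivity) fun x => (hv x).1
  have h2 : ‖(e.symm : LinearMap.range v →L[𝕜] A)‖ ≤ 1 + δ := by
    refine ContinuousLinearMap.opNorm_le_bound _ (by positivity) fun y => ?_
    have := (hv (e.symm y)).2
    rw [← he, e.apply_symm_apply] at this
    exact this
  calc _ ≤ (1 + δ) * (1 + δ) := mul_le_mul h1 h2 (norm_nonneg _) (by positivity)
    _ ≤ 1 + ε := by nlinarith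

end FiniteRepresentability

/-! ### Banach space ultrapowers -/

section Ultrapower

variable (𝕜 : Type) [RCLike 𝕜] {I : Type u} (X : Type u) [NormedAddCommGroup X] [NormedSpace 𝕜 X]

/-- The bounded families in `X` that tend to `0` along the filter `U`. -/
def nullFamilies (U : Filter I) : Submodule 𝕜 (lp (fun _ : I => X) ∞) where
  carrier := {x | Tendsto (fun i => x i) U (𝓝 0)}
  zero_mem' := tendsto_const_nhds
  add_mem' {x y} hx hy := by simpa using Tendsto.add hx hy
  smul_mem' c x hx := by simpa using Tendsto.const_smul hx c

variable {X}

theorem mem_nullFamilies {U : Filter I} {x : lp (fun _ : I => X) ∞} :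
    x ∈ nullFamilies 𝕜 X U ↔ Tendsto (fun i => x i) U (𝓝 0) := Iff.rfl

variable (X)

instance isClosed_nullFamilies (U : Filter I) :
    IsClosed (nullFamilies 𝕜 X U : Set (lp (fun _ : I => X) ∞)) := by
  refine isClosed_of_closure_subset fun x hx => ?_
  rw [SetLike.mem_coe, mem_nullFamilies, Metric.tendsto_nhds]
  intro ε hε
  obtain ⟨y, hy, hxy⟩ := Metric.mem_closure_iff.1 hx (ε / 2) (half_pos hε)
  filter_upwards [Metric.tendsto_nhds.1 ((mem_nullFamilies 𝕜).1 hy) (ε / 2) (half_pos hε)]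
    with i hi
  have h1 : ‖x i - y i‖ ≤ ‖x - y‖ := lp.norm_apply_le_norm ENNReal.top_ne_zero (x - y) i
  rw [dist_eq_norm] at hxy
  rw [dist_zero_right] at hi ⊢
  have h2 := norm_le_norm_add_norm_sub' (x i) (y i)
  linarith

/-- The ultrapower of the Banach space `X` with respect to `U`. -/
abbrev BanachUltrapower (U : Filter I) : Type u :=
  lp (fun _ : I => X) ∞ ⧸ nullFamilies 𝕜 X U

variable {X}

theorem memℓp_infty_of_norm_le {x : I → X} {C : ℝ} (h : ∀ i, ‖x i‖ ≤ C) : Memℓp x ∞ :=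
  memℓp_infty ⟨C, by rintro _ ⟨i, rfl⟩; exact h i⟩

/-- The norm of a class in the ultrapower is the limit of the norms of the coordinates. -/
theorem tendsto_norm_mk_ultrapower (U : Ultrafilter I) (x : lp (fun _ : I => X) ∞) :
    Tendsto (fun i => ‖x i‖) U (𝓝 ‖(nullFamilies 𝕜 X (U : Filter I)).mkQ x‖) := by
  classical
  rw [tendsto_order]
  constructor
  · intro a ha
    by_contra hcon
    -- Along an ultrafilter the negation becomes eventual, so truncating `x` at height `a` changes
    -- it only by a null family.
    rw [← Ultrafilter.eventually_not] at hcon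
    simp only [not_lt] at hcon
    have ha0 : 0 ≤ a := by
      obtain ⟨i, hi⟩ := hcon.exists
      exact (norm_nonneg _).trans hi
    have hle : ∀ i, ‖(if ‖x i‖ ≤ a then x i else 0 : X)‖ ≤ a := by
      intro i
      split_ifs with h
      · exact h
      · simpa using ha0
    let m : lp (fun _ : I => X) ∞ := ⟨fun i => if ‖x i‖ ≤ a then x i else 0,
      memℓp_infty_of_norm_le hle⟩
    have hmem : x - m ∈ nullFamilies 𝕜 X (U : Filter I) := by
      rw [mem_nullFamilies]
      refine (tendsto_congr' ?_).2 tendsto_const_nhds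
      filter_upwards [hcon] with i hi
      change x i - (if ‖x i‖ ≤ a then x i else 0) = 0
      rw [if_pos hi, sub_self]
    have heq : (nullFamilies 𝕜 X (U : Filter I)).mkQ x = (nullFamilies 𝕜 X (U : Filter I)).mkQ m :=
      (Submodule.Quotient.eq _).2 hmem
    rw [heq] at ha
    exact absurd (ha.trans_le ((Submodule.Quotient.norm_mk_le _ m).trans
      (lp.norm_le_of_forall_le ha0 hle))) (lt_irrefl a)
  · intro b hb
    obtain ⟨m, hm, hmb⟩ := Submodule.Quotient.norm_mk_lt
      ((nullFamilies 𝕜 X (U : Filter I)).mkQ x) (sub_pos.2 hb)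
    have hmem : x - m ∈ nullFamilies 𝕜 X (U : Filter I) := (Submodule.Quotient.eq _).1 hm.symm
    have hmb' : 0 < b - ‖m‖ := by linarith
    filter_upwards [Metric.tendsto_nhds.1 ((mem_nullFamilies 𝕜).1 hmem) _ hmb'] with i hi
    rw [dist_zero_right] at hi
    change ‖x i - m i‖ < _ at hi
    have h1 := lp.norm_apply_le_norm ENNReal.top_ne_zero m i
    have h2 := norm_le_norm_add_norm_sub' (x i) (m i)
    linarith

theorem finitelyRepresentable_ultrapower (U : Ultrafilter I) :
    FinitelyRepresentable 𝕜 X (BanachUltrapower 𝕜 X (U : Filter I)) := by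
  let d : X →ₗ[𝕜] lp (fun _ : I => X) ∞ :=
    { toFun := fun x => ⟨fun _ => x, memℓp_infty_of_norm_le fun _ => le_rfl⟩
      map_add' := fun _ _ => rfl
      map_smul' := fun _ _ => rfl }
  refine .of_exists_linearMap fun ε hε A _ =>
    ⟨(nullFamilies 𝕜 X (U : Filter I)).mkQ ∘ₗ d ∘ₗ A.subtype, fun x => ?_⟩
  have hx : ‖((nullFamilies 𝕜 X (U : Filter I)).mkQ ∘ₗ d ∘ₗ A.subtype) x‖ = ‖x‖ :=
    tendsto_nhds_unique (tendsto_norm_mk_ultrapower 𝕜 U (d x)) tendsto_const_nhds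
  rw [hx]
  have := norm_nonneg x
  constructor <;> nlinarith

/-- Lift `A` linearly to bounded families. The norms of the coordinate maps converge pointwise to
the norm of `A`; a finite net of the compact unit sphere makes one coordinate work uniformly. -/
theorem ultrapower_finitelyRepresentable (U : Ultrafilter I) :
    FinitelyRepresentable 𝕜 (BanachUltrapower 𝕜 X (U : Filter I)) X := by
  obtain ⟨σ, hσ⟩ := LinearMap.exists_rightInverse_of_surjective
    (nullFamilies 𝕜 X (U : Filter I)).mkQ (Submodule.range_mkQ _)
  refine .of_exists_linearMap fun ε hε A hA => ?_
  have : ProperSpace A := FiniteDimensional.proper 𝕜 A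
  let s : A →L[𝕜] lp (fun _ : I => X) ∞ := LinearMap.toContinuousLinearMap (σ ∘ₗ A.subtype)
  let u : I → A →ₗ[𝕜] X := fun i =>
    { toFun := fun a => s a i
      map_add' := fun a b => by rw [map_add]; rfl
      map_smul' := fun c a => by rw [map_smul]; rfl }
  have hu : ∀ i a, ‖u i a‖ ≤ ‖s‖ * ‖a‖ := fun i a =>
    (lp.norm_apply_le_norm ENNReal.top_ne_zero (s a) i).trans (s.le_opNorm a)
  have hlim : ∀ a : A, Tendsto (fun i => ‖u i a‖) U (𝓝 ‖a‖) := by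
    intro a
    have h1 := tendsto_norm_mk_ultrapower 𝕜 U (s a)
    have h2 : (nullFamilies 𝕜 X (U : Filter I)).mkQ (s a) = a := LinearMap.congr_fun hσ a
    rw [h2] at h1
    exact h1
  -- Chosen so that `(1 + ε)(1 - δ) = 1`.
  set δ : ℝ := ε / (1 + ε) with hδ
  have hδ0 : 0 < δ := by positivity
  have hδε : δ * (1 + ε) = ε := by rw [hδ]; field_simp
  have hK : 0 < ‖s‖ + 2 := by positivity
  -- The net error is `‖s‖ r` for moving `a` to `t` under `u i`, plus `r` at `t`, plus `r` for `‖t‖`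
  -- against `‖a‖`.
  obtain ⟨T, -, hT, hcov⟩ :=
    (isCompact_sphere (0 : A) 1).finite_cover_balls (e := δ / (‖s‖ + 2)) (by positivity)
  have hr : δ / (‖s‖ + 2) * (‖s‖ + 2) = δ := by field_simp
  set r : ℝ := δ / (‖s‖ + 2)
  have hr0 : 0 < r := by positivity
  have hev : ∀ᶠ i in (U : Filter I), ∀ t ∈ T, |‖u i t‖ - ‖t‖| < r := by
    rw [eventually_all_finite hT]
    intro t _
    filter_upwards [Metric.tendsto_nhds.1 (hlim t) r hr0] with i hi
    rwa [Real.dist_eq] at hi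
  obtain ⟨i, hi⟩ := hev.exists
  have hunit : ∀ a : A, ‖a‖ = 1 → |‖u i a‖ - 1| ≤ δ := by
    intro a ha
    obtain ⟨t, htT, hat⟩ : ∃ t ∈ T, a ∈ Metric.ball t r := by
      simpa using hcov (show a ∈ Metric.sphere (0 : A) 1 by simpa using ha)
    rw [Metric.mem_ball, dist_eq_norm] at hat
    have h1 : |‖u i a‖ - ‖u i t‖| ≤ ‖s‖ * r := by
      refine (abs_norm_sub_norm_le _ _).trans ?_
      rw [← map_sub]
      exact (hu i _).trans (mul_le_mul_of_nonneg_left hat.le (by positivity))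
    have h2 : |‖a‖ - ‖t‖| ≤ r := (abs_norm_sub_norm_le _ _).trans hat.le
    have h3 := hi t htT
    rw [ha] at h2
    rw [abs_le] at h1 h2 ⊢
    rw [abs_lt] at h3
    constructor <;> nlinarith
  refine ⟨u i, fun a => ?_⟩
  rcases eq_or_ne a 0 with rfl | ha
  · simp
  have ha' : 0 < ‖a‖ := norm_pos_iff.2 ha
  have h1 := hunit ((((‖a‖⁻¹ : ℝ)) : 𝕜) • a) (by
    rw [norm_smul, RCLike.norm_ofReal, abs_of_pos (inv_pos.2 ha'), inv_mul_cancel₀ ha'.ne'])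
  rw [map_smul, norm_smul, RCLike.norm_ofReal, abs_of_pos (inv_pos.2 ha')] at h1
  set q : ℝ := ‖a‖⁻¹ * ‖u i a‖ with hq
  have hqa : ‖u i a‖ = q * ‖a‖ := by rw [hq]; field_simp
  rw [abs_le] at h1
  rw [hqa]
  have hδle : δ ≤ ε := by nlinarith
  refine ⟨mul_le_mul_of_nonneg_right (by linarith) ha'.le, ?_⟩
  have : 1 ≤ (1 + ε) * q := by nlinarith
  nlinarith

theorem finitelyEquivalent_ultrapower (U : Ultrafilter I) :
    FinitelyEquivalent 𝕜 X (BanachUltrapower 𝕜 X (U : Filter I)) :=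
  ⟨finitelyRepresentable_ultrapower 𝕜 U, ultrapower_finitelyRepresentable 𝕜 U⟩

variable {𝕜}

/-- A family of maps that is asymptotically linear and contractive along `U` induces a linear
contraction into the ultrapower. -/
theorem exists_contraction_ultrapower {F : Type u} [NormedAddCommGroup F] [NormedSpace 𝕜 F]
    (U : Ultrafilter I) (w : I → F → X)
    (hw : ∀ a : F →₀ 𝕜, ∀ ε : ℝ, 0 < ε → ∀ᶠ i in (U : Filter I),
      ‖linearCombination 𝕜 (w i) a‖ ≤ ‖linearCombination 𝕜 id a‖ + ε) :
    ∃ S : F →ₗ[𝕜] BanachUltrapower 𝕜 X (U : Filter I), (∀ φ, ‖S φ‖ ≤ ‖φ‖) ∧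
      ∀ φ, Tendsto (fun i => ‖w i φ‖) U (𝓝 ‖S φ‖) := by
  classical
  -- The family `w i φ` may be unbounded in `i`; the cut-off alters it only off a set of `U`.
  have hle : ∀ φ i, ‖(if ‖w i φ‖ ≤ ‖φ‖ + 1 then w i φ else 0 : X)‖ ≤ ‖φ‖ + 1 := by
    intro φ i
    split_ifs with h
    · exact h
    · rw [norm_zero]; positivity
  let x : F → lp (fun _ : I => X) ∞ := fun φ =>
    ⟨fun i => if ‖w i φ‖ ≤ ‖φ‖ + 1 then w i φ else 0, memℓp_infty_of_norm_le (hle φ)⟩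
  have hbound : ∀ φ, ∀ ε : ℝ, 0 < ε → ∀ᶠ i in (U : Filter I), ‖w i φ‖ ≤ ‖φ‖ + ε := by
    intro φ ε hε
    filter_upwards [hw (single φ 1) ε hε] with i hi
    simpa using hi
  have hx : ∀ φ, ∀ᶠ i in (U : Filter I), x φ i = w i φ := by
    intro φ
    filter_upwards [hbound φ 1 one_pos] with i hi
    exact if_pos hi
  -- Additivity and homogeneity are formal combinations with value `0`, so one estimate yields both.
  have hnull : ∀ a : F →₀ 𝕜, linearCombination 𝕜 id a = 0 →
      Tendsto (fun i => linearCombination 𝕜 (w i) a) U (𝓝 0) := by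
    intro a ha
    rw [Metric.tendsto_nhds]
    intro ε hε
    filter_upwards [hw a (ε / 2) (half_pos hε)] with i hi
    rw [ha, norm_zero, zero_add] at hi
    rw [dist_zero_right]
    linarith
  have hlim : ∀ φ, Tendsto (fun i => ‖w i φ‖) U
      (𝓝 ‖(nullFamilies 𝕜 X (U : Filter I)).mkQ (x φ)‖) := by
    intro φ
    refine (tendsto_norm_mk_ultrapower 𝕜 U (x φ)).congr' ?_
    filter_upwards [hx φ] with i hi
    rw [hi]
  let S : F →ₗ[𝕜] BanachUltrapower 𝕜 X (U : Filter I) :=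
    { toFun := fun φ => (nullFamilies 𝕜 X (U : Filter I)).mkQ (x φ)
      map_add' := fun φ ψ => by
        rw [← map_add]
        refine (Submodule.Quotient.eq _).2 ?_
        rw [mem_nullFamilies]
        refine (hnull (single (φ + ψ) 1 - (single φ 1 + single ψ 1)) (by simp)).congr' ?_
        filter_upwards [hx φ, hx ψ, hx (φ + ψ)] with i h1 h2 h3
        change _ = x (φ + ψ) i - (x φ i + x ψ i)
        simp [h1, h2, h3]
      map_smul' := fun c φ => by
        rw [RingHom.id_apply, ← map_smul]
        refine (Submodule.Quotient.eq _).2 ?_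
        rw [mem_nullFamilies]
        refine (hnull (single (c • φ) 1 - single φ c) (by simp)).congr' ?_
        filter_upwards [hx φ, hx (c • φ)] with i h1 h2
        change _ = x (c • φ) i - c • x φ i
        simp [h1, h2] }
  exact ⟨S, fun φ => le_of_forall_pos_le_add fun ε hε =>
    le_of_tendsto (hlim φ) (hbound φ ε hε), hlim⟩

end Ultrapower

/-! ### Helly-type local reflexivity -/

section LocalReflexivity

variable {𝕜 : Type} [RCLike 𝕜] {E : Type u} [NormedAddCommGroup E] [NormedSpace 𝕜 E]

/-- A vector of norm below `1` nearly norming `g`, rotated to make `g` positive on it and scaled by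
`‖ψ‖ + ε`, gives `g` a value of at least `‖ψ‖ ‖g‖`. -/
theorem exists_norm_lt_re_le (ψ : StrongDual 𝕜 (StrongDual 𝕜 E)) (g : StrongDual 𝕜 E) {ε : ℝ}
    (hε : 0 < ε) : ∃ v : E, ‖v‖ < ‖ψ‖ + ε ∧ RCLike.re (ψ g) ≤ RCLike.re (g v) := by
  have hR : 0 < ‖ψ‖ + ε := by positivity
  rcases eq_or_ne g 0 with rfl | hg
  · exact ⟨0, by simpa using hR, by simp⟩
  have hg' : 0 < ‖g‖ := norm_pos_iff.2 hg
  have hlt : ‖ψ‖ * ‖g‖ / (‖ψ‖ + ε) < ‖g‖ := by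
    rw [div_lt_iff₀ hR]
    nlinarith
  obtain ⟨x, hx, hgx⟩ := g.exists_lt_apply_of_lt_opNorm hlt
  rw [div_lt_iff₀ hR] at hgx
  have hpos : 0 < ‖g x‖ := by
    by_contra h
    have h0 : ‖g x‖ = 0 := le_antisymm (not_lt.1 h) (norm_nonneg _)
    rw [h0, zero_mul] at hgx
    exact absurd hgx (not_lt.2 (by positivity))
  set R : ℝ := ‖ψ‖ + ε
  refine ⟨(((R / ‖g x‖ : ℝ) : 𝕜) * (starRingEnd 𝕜) (g x)) • x, ?_, ?_⟩
  · rw [norm_smul, norm_mul, RCLike.norm_ofReal, RCLike.norm_conj, abs_of_pos (by positivity),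
      div_mul_cancel₀ _ hpos.ne']
    nlinarith
  · rw [map_smul, smul_eq_mul, mul_assoc, RCLike.conj_mul, ← RCLike.ofReal_pow,
      ← RCLike.ofReal_mul, RCLike.ofReal_re]
    have h1 : R / ‖g x‖ * ‖g x‖ ^ 2 = ‖g x‖ * R := by field_simp
    rw [h1]
    exact (RCLike.re_le_norm _).trans ((ψ.le_opNorm g).trans hgx.le)

/-- A Helly type form of the principle of local reflexivity: finitely many norm inequalities
between linear combinations of elements of the bidual are almost satisfied in the space. -/
theorem exists_finsupp_approx_bidual
    (t : Finset ((StrongDual 𝕜 (StrongDual 𝕜 E) →₀ 𝕜) × E)) {ε : ℝ} (hε : 0 < ε) :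
    ∃ z : StrongDual 𝕜 (StrongDual 𝕜 E) →₀ E, ∀ p ∈ t,
      ‖linearCombination 𝕜 z p.1 - p.2‖ <
        ‖linearCombination 𝕜 id p.1 - NormedSpace.inclusionInDoubleDual 𝕜 E p.2‖ + ε := by
  classical
  let _ : NormedSpace ℝ E := NormedSpace.restrictScalars ℝ 𝕜 E
  have : IsScalarTower ℝ 𝕜 E := RestrictScalars.isScalarTower ℝ 𝕜 E
  let D := StrongDual 𝕜 (StrongDual 𝕜 E)
  let Ψ : (D →₀ 𝕜) × E → D := fun p =>
    linearCombination 𝕜 id p.1 - NormedSpace.inclusionInDoubleDual 𝕜 E p.2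
  let C : Set (t → E) := Set.pi Set.univ fun p => Metric.ball p.1.2 (‖Ψ p.1‖ + ε)
  let A : (D →₀ E) →ₗ[𝕜] (t → E) := LinearMap.pi fun p =>
    ∑ φ ∈ p.1.1.support, p.1.1 φ • Finsupp.lapply φ
  have hA : ∀ z p, A z p = linearCombination 𝕜 z p.1.1 := by
    intro z p
    simp only [A, LinearMap.pi_apply, LinearMap.sum_apply, LinearMap.smul_apply, lapply_apply]
    rfl
  -- A solution `z` is a point of the range of `A` in the open convex set `C`. Otherwise Hahn–Banach
  -- separates the two.
  by_contra hcon
  have hdisj : Disjoint C (LinearMap.range A : Set (t → E)) := by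
    rw [Set.disjoint_right]
    rintro _ ⟨z, rfl⟩ hz
    refine hcon ⟨z, fun p hp => ?_⟩
    have := hz ⟨p, hp⟩ (Set.mem_univ _)
    rwa [hA, mem_ball_iff_norm] at this
  obtain ⟨f, b, hf1, hf2⟩ := RCLike.geometric_hahn_banach_open (𝕜 := 𝕜)
    (convex_pi fun p _ => convex_ball _ _)
    (isOpen_set_pi Set.finite_univ fun p _ => Metric.isOpen_ball)
    ((LinearMap.range A).restrictScalars ℝ).convex hdisj
  have hb : b ≤ 0 := by simpa using hf2 0 (zero_mem _)
  have hfA : ∀ z, f (A z) = 0 := by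
    intro z
    by_contra hne
    -- A functional bounded below on a subspace vanishes there: rescale to reach the value `b - 1`.
    have := hf2 (A ((((b - 1 : ℝ) : 𝕜) * (f (A z))⁻¹) • z)) ⟨_, rfl⟩
    rw [LinearMap.map_smul, ContinuousLinearMap.map_smul, smul_eq_mul, mul_assoc,
      inv_mul_cancel₀ hne, mul_one, RCLike.ofReal_re] at this
    linarith
  let g : t → StrongDual 𝕜 E := fun p => f.comp (ContinuousLinearMap.single 𝕜 (fun _ : t => E) p)
  have hfg : ∀ y : t → E, f y = ∑ p, g p (y p) := by
    intro y
    conv_lhs => rw [← Finset.univ_sum_single y]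
    rw [map_sum]
    rfl
  have hg : ∀ φ : D, ∑ p : t, p.1.1 φ • g p = 0 := by
    intro φ
    ext e
    have h1 := hfA (single φ e)
    rw [hfg] at h1
    rw [_root_.sum_apply, _root_.zero_apply, ← h1]
    refine Finset.sum_congr rfl fun p _ => ?_
    have h2 : A (single φ e) p = p.1.1 φ • e := by
      rw [hA, linearCombination_apply, Finsupp.sum, Finset.sum_eq_single φ]
      · simp
      · intro ψ _ hψ
        simp [hψ.symm]
      · intro hφ
        simp [Finsupp.notMem_support_iff.1 hφ]
    rw [h2, map_smul]
    rfl
  -- Apply each `φ` to its relation in `hg` and sum over `φ`.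
  have hsum : ∑ p : t, (linearCombination 𝕜 id p.1.1 : D) (g p) = 0 := by
    have hT : ∀ p : t, (linearCombination 𝕜 id p.1.1 : D) (g p) =
        ∑ φ ∈ t.biUnion fun p => p.1.support, p.1.1 φ * φ (g p) := by
      intro p
      rw [linearCombination_apply, Finsupp.sum_of_support_subset _
        (Finset.subset_biUnion_of_mem (fun p : (D →₀ 𝕜) × E => p.1.support) p.2) _ (by simp),
        _root_.sum_apply]
      rfl
    rw [Finset.sum_congr rfl fun p _ => hT p, Finset.sum_comm]
    refine Finset.sum_eq_zero fun φ _ => ?_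
    have := congrArg φ (hg φ)
    rw [map_zero, map_sum] at this
    simpa using this
  choose v hv1 hv2 using fun p : t => exists_norm_lt_re_le (Ψ p.1) (g p) hε
  -- This point of `C` gives `f` real part at least that of the sum in `hsum`, which is `0`, against
  -- `re f < b ≤ 0` on `C`.
  have hmem : (fun p : t => p.1.2 + v p) ∈ C := by
    intro p _
    rw [mem_ball_iff_norm, add_sub_cancel_left]
    exact hv1 p
  have h1 := hf1 _ hmem
  have h2 : RCLike.re (∑ p : t, (linearCombination 𝕜 id p.1.1 : D) (g p)) ≤
      RCLike.re (f fun p : t => p.1.2 + v p) := by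
    rw [hfg, map_sum, map_sum]
    refine Finset.sum_le_sum fun p _ => ?_
    have h3 := hv2 p
    have h4 : Ψ p.1 (g p) = (linearCombination 𝕜 id p.1.1 : D) (g p) - g p p.1.2 := rfl
    rw [h4, map_sub] at h3
    rw [map_add, map_add]
    linarith
  rw [hsum, map_zero] at h2
  linarith

end LocalReflexivity

/-! ### Contractive left inverses and the equivalences -/

section Complementation

variable {𝕜 : Type} [RCLike 𝕜]

/-- If `E` is finitely representable in `X`, then its bidual is mapped to some ultrapower of `X`
by a contraction that is isometric on `E`. -/
theorem exists_contraction_bidual_ultrapower {X E : Type u}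
    [NormedAddCommGroup X] [NormedSpace 𝕜 X] [NormedAddCommGroup E] [NormedSpace 𝕜 E]
    (h : FinitelyRepresentable 𝕜 E X) :
    ∃ (I : Type u) (U : Ultrafilter I)
      (S : StrongDual 𝕜 (StrongDual 𝕜 E) →ₗ[𝕜] BanachUltrapower 𝕜 X (U : Filter I)),
      (∀ φ, ‖S φ‖ ≤ ‖φ‖) ∧ ∀ x : E, ‖S (NormedSpace.inclusionInDoubleDual 𝕜 E x)‖ = ‖x‖ := by
  classical
  -- An index is a finite set of norm conditions with an accuracy `1 / (n + 1)`; each condition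
  -- eventually belongs to it.
  let I : Type u := Finset ((StrongDual 𝕜 (StrongDual 𝕜 E) →₀ 𝕜) × E) × ℕ
  let r : I → ℝ := fun i => 1 / ((i.2 : ℝ) + 1)
  have hr : ∀ i, 0 < r i := fun i => Nat.one_div_pos_of_nat
  choose z hz using fun i : I => exists_finsupp_approx_bidual i.1 (hr i)
  have hspan : ∀ i, ∃ v : E →ₗ[𝕜] X, ∀ x ∈ Submodule.span 𝕜 (Set.range (z i)),
      ‖v x‖ ≤ ‖x‖ ∧ ‖x‖ ≤ (1 + r i) * ‖v x‖ := by
    intro i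
    have : FiniteDimensional 𝕜 (Submodule.span 𝕜 (Set.range (z i))) :=
      FiniteDimensional.span_of_finite 𝕜 (z i).finite_range
    exact h.exists_linearMap (hr i) _
  choose v hv using hspan
  let U : Ultrafilter I := Ultrafilter.of atTop
  have hU : (U : Filter I) ≤ atTop := Ultrafilter.of_le _
  have hrlim : Tendsto r U (𝓝 0) := by
    refine (tendsto_one_div_add_atTop_nhds_zero_nat (𝕜 := ℝ)).comp (Tendsto.mono_left ?_ hU)
    rw [← prod_atTop_atTop_eq]
    exact tendsto_snd
  have hmem : ∀ p, ∀ᶠ i in (U : Filter I), p ∈ i.1 := by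
    intro p
    refine hU ?_
    filter_upwards [eventually_ge_atTop (({p}, 0) : I)] with i hi
    exact hi.1 (Finset.mem_singleton_self p)
  obtain ⟨S, hS, hlim⟩ := exists_contraction_ultrapower (𝕜 := 𝕜) U (fun i φ => v i (z i φ)) (by
    intro a ε hε
    filter_upwards [hmem (a, 0), (tendsto_order.1 hrlim).2 ε hε] with i hi hri
    have h1 : linearCombination 𝕜 (fun φ => v i (z i φ)) a = v i (linearCombination 𝕜 (z i) a) :=
      (Finsupp.apply_linearCombination 𝕜 (v i) (z i) a).symm
    have h2 : linearCombination 𝕜 (z i) a ∈ Submodule.span 𝕜 (Set.range (z i)) := by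
      rw [← Finsupp.range_linearCombination]
      exact ⟨a, rfl⟩
    have h3 := hz i _ hi
    have h4 : ‖linearCombination 𝕜 id a - NormedSpace.inclusionInDoubleDual 𝕜 E 0‖ =
        ‖linearCombination 𝕜 id a‖ := by
      rw [map_zero]
      exact congrArg norm (ContinuousLinearMap.ext fun f => sub_zero _)
    rw [h4, sub_zero] at h3
    rw [h1]
    linarith [(hv i _ h2).1])
  refine ⟨I, U, S, hS, fun x => le_antisymm ?_ ?_⟩
  · exact (hS _).trans (NormedSpace.double_dual_bound 𝕜 E x)
  · have h1 : Tendsto (fun i => ‖x‖ - r i) U (𝓝 ‖x‖) := by simpa using hrlim.const_sub ‖x‖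
    have h2 := (hrlim.const_add 1).mul (hlim (NormedSpace.inclusionInDoubleDual 𝕜 E x))
    rw [add_zero, one_mul] at h2
    refine le_of_tendsto_of_tendsto h1 h2 ?_
    -- This condition has bidual norm `0`, so it places `z i` of the image of `x` within `r i` of
    -- `x`.
    filter_upwards [hmem (single (NormedSpace.inclusionInDoubleDual 𝕜 E x) 1, x)] with i hi
    have h3 := hz i _ hi
    have h6 : ‖NormedSpace.inclusionInDoubleDual 𝕜 E x -
        NormedSpace.inclusionInDoubleDual 𝕜 E x‖ = 0 :=
      (congrArg norm (ContinuousLinearMap.ext fun f => sub_self _)).trans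
        ContinuousLinearMap.opNorm_zero
    simp only [linearCombination_single, one_smul, id] at h3
    rw [h6, zero_add] at h3
    have h4 := (hv i _ (Submodule.subset_span
      ⟨NormedSpace.inclusionInDoubleDual 𝕜 E x, rfl⟩)).2
    have h5 := norm_le_norm_add_norm_sub' x (z i (NormedSpace.inclusionInDoubleDual 𝕜 E x))
    rw [norm_sub_rev] at h5
    linarith

theorem norm_doubleAdjoint_apply_le {E F : Type u} [NormedAddCommGroup E] [NormedSpace 𝕜 E]
    [NormedAddCommGroup F] [NormedSpace 𝕜 F] {T : E →L[𝕜] F} (hT : ∀ x, ‖T x‖ ≤ ‖x‖)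
    (φ : StrongDual 𝕜 (StrongDual 𝕜 E)) : ‖doubleAdjoint T φ‖ ≤ ‖φ‖ := by
  refine ContinuousLinearMap.opNorm_le_bound _ (by positivity) fun f => ?_
  rw [doubleAdjoint_apply]
  refine φ.le_of_opNorm_le_of_le le_rfl ?_
  exact ContinuousLinearMap.opNorm_le_bound _ (by positivity) fun x =>
    f.le_of_opNorm_le_of_le le_rfl (hT x)

/-- By Hahn–Banach every functional on `E` is `g ∘ i` for some `g` of no larger norm, so testing on
such `g` loses nothing. -/
theorem norm_doubleAdjoint_linearIsometry {E F : Type u} [NormedAddCommGroup E] [NormedSpace 𝕜 E]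
    [NormedAddCommGroup F] [NormedSpace 𝕜 F] (i : E →ₗᵢ[𝕜] F)
    (φ : StrongDual 𝕜 (StrongDual 𝕜 E)) : ‖doubleAdjoint i.toContinuousLinearMap φ‖ = ‖φ‖ := by
  refine le_antisymm (norm_doubleAdjoint_apply_le (fun x => (i.norm_map x).le) φ) ?_
  refine ContinuousLinearMap.opNorm_le_bound _ (by positivity) fun f => ?_
  let e := i.equivRange
  let f' : StrongDual 𝕜 (LinearMap.range i.toLinearMap) :=
    f.comp (e.symm.toLinearIsometry.toContinuousLinearMap)
  obtain ⟨g, hg, hgn⟩ := exists_extension_norm_eq _ f'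
  have hf' : ‖f'‖ ≤ ‖f‖ := by
    refine ContinuousLinearMap.opNorm_le_bound _ (norm_nonneg _) fun y => ?_
    have := f.le_opNorm (e.symm y)
    rwa [e.symm.norm_map] at this
  have hgf : g.comp i.toContinuousLinearMap = f := by
    ext x
    have h1 : g (i x) = f' (e x) := hg (e x)
    have h2 : f' (e x) = f (e.symm (e x)) := rfl
    rw [e.symm_apply_apply] at h2
    exact h1.trans h2
  have h1 := (doubleAdjoint i.toContinuousLinearMap φ).le_opNorm g
  rw [doubleAdjoint_apply, hgf] at h1
  exact h1.trans (mul_le_mul_of_nonneg_left (hgn.le.trans hf') (by positivity))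

/-- A norm one projection onto the range of an isometric embedding yields a contractive left
inverse of the embedding. -/
theorem IsNormOneProjectionOnto.exists_leftInverse {E F : Type u} [NormedAddCommGroup E]
    [NormedSpace 𝕜 E] [NormedAddCommGroup F] [NormedSpace 𝕜 F] (i : E →ₗ[𝕜] F)
    (hi : ∀ x, ‖i x‖ = ‖x‖) {P : F →L[𝕜] F}
    (hP : IsNormOneProjectionOnto P (LinearMap.range i)) :
    ∃ p : F →L[𝕜] E, (∀ x, p (i x) = x) ∧ ∀ y, ‖p y‖ ≤ ‖y‖ := by
  let e := (⟨i, hi⟩ : E →ₗᵢ[𝕜] F).equivRange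
  let P' : F →L[𝕜] LinearMap.range i := P.codRestrict _ hP.mem
  refine ⟨(e.symm.toLinearIsometry.toContinuousLinearMap).comp P', fun x => ?_, fun y => ?_⟩
  · have h1 : P' (i x) = e x := Subtype.ext (hP.eq_self (i x) ⟨x, rfl⟩)
    change e.symm (P' (i x)) = x
    rw [h1, e.symm_apply_apply]
  · change ‖e.symm (P' y)‖ ≤ _
    rw [e.symm.norm_map]
    exact (P.le_of_opNorm_le hP.norm_le y).trans_eq (one_mul _)

/-- A contractive left inverse `p` of a linear contraction `i` yields the norm one projection
`i p` onto the range of `i`. -/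
theorem exists_isNormOneProjectionOnto_range {E F : Type u} [NormedAddCommGroup E]
    [NormedSpace 𝕜 E] [NormedAddCommGroup F] [NormedSpace 𝕜 F] (i : E →ₗ[𝕜] F)
    (hi : ∀ x, ‖i x‖ ≤ ‖x‖) (p : F →ₗ[𝕜] E) (hpi : ∀ x, p (i x) = x) (hp : ∀ y, ‖p y‖ ≤ ‖y‖) :
    ∃ P : F →L[𝕜] F, IsNormOneProjectionOnto P (LinearMap.range i) := by
  have h : ∀ y, ‖(i ∘ₗ p) y‖ ≤ 1 * ‖y‖ := fun y =>
    ((hi _).trans (hp y)).trans_eq (one_mul _).symm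
  refine ⟨(i ∘ₗ p).mkContinuous 1 h, fun x => ⟨p x, rfl⟩, ?_,
    (i ∘ₗ p).mkContinuous_norm_le zero_le_one h⟩
  rintro _ ⟨x, rfl⟩
  exact congrArg i (hpi x)

variable {X E : Type u} [NormedAddCommGroup X] [NormedSpace 𝕜 X]
  [NormedAddCommGroup E] [NormedSpace 𝕜 E]

theorem UniversallyComplementedIn.algebraicallyClosedIn (h : UniversallyComplementedIn 𝕜 X E) :
    AlgebraicallyClosedIn 𝕜 X E := by
  intro Z _ _ _ hZ i
  obtain ⟨P, hP⟩ := h Z hZ i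
  obtain ⟨p, hpi, hp⟩ := hP.exists_leftInverse i.toLinearMap i.norm_map
  exact @exists_isNormOneProjectionOnto_range 𝕜 _
    (StrongDual 𝕜 (StrongDual 𝕜 E)) (StrongDual 𝕜 (StrongDual 𝕜 Z)) _ _ _ _
    (doubleAdjoint i.toContinuousLinearMap).toLinearMap
    (by exact norm_doubleAdjoint_apply_le fun x => (i.norm_map x).le)
    (doubleAdjoint p).toLinearMap
    (fun φ => by
      refine ContinuousLinearMap.ext fun f => ?_
      exact congrArg φ (ContinuousLinearMap.ext fun x => congrArg f (hpi x)))
    (by exact norm_doubleAdjoint_apply_le hp)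

theorem UniversallyComplementedIn.quasiDual [CompleteSpace X]
    (h : UniversallyComplementedIn 𝕜 X E) (hE : FinitelyRepresentable 𝕜 E X) :
    QuasiDual 𝕜 E := by
  obtain ⟨I, U, S, hS, hiso⟩ := exists_contraction_bidual_ultrapower hE
  let i : E →ₗᵢ[𝕜] BanachUltrapower 𝕜 X (U : Filter I) :=
    ⟨S ∘ₗ (NormedSpace.inclusionInDoubleDual 𝕜 E).toLinearMap, hiso⟩
  obtain ⟨P, hP⟩ := h _ (finitelyEquivalent_ultrapower 𝕜 U) i
  obtain ⟨p, hpi, hp⟩ := hP.exists_leftInverse i.toLinearMap i.norm_map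
  exact @exists_isNormOneProjectionOnto_range 𝕜 _ E (StrongDual 𝕜 (StrongDual 𝕜 E)) _ _ _ _
    (NormedSpace.inclusionInDoubleDual 𝕜 E).toLinearMap
    (by exact NormedSpace.double_dual_bound 𝕜 E)
    (p.toLinearMap ∘ₗ S) (by exact hpi) (by exact fun φ => (hp _).trans (hS φ))

/-- The composite is the identity on `E` because `i**` extends `i` along the canonical embeddings.
-/
theorem AlgebraicallyClosedIn.universallyComplementedIn (h : AlgebraicallyClosedIn 𝕜 X E)
    (hq : QuasiDual 𝕜 E) : UniversallyComplementedIn 𝕜 X E := by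
  intro Z _ _ _ hZ i
  obtain ⟨P, hP⟩ := h Z hZ i
  obtain ⟨Q, hQ⟩ := hq
  obtain ⟨p, hpi, hp⟩ := @IsNormOneProjectionOnto.exists_leftInverse 𝕜 _
    (StrongDual 𝕜 (StrongDual 𝕜 E)) (StrongDual 𝕜 (StrongDual 𝕜 Z)) _ _ _ _
    (doubleAdjoint i.toContinuousLinearMap).toLinearMap
    (by exact norm_doubleAdjoint_linearIsometry i) P hP
  obtain ⟨q, hqi, hq⟩ := @IsNormOneProjectionOnto.exists_leftInverse 𝕜 _
    E (StrongDual 𝕜 (StrongDual 𝕜 E)) _ _ _ _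
    (NormedSpace.inclusionInDoubleDual 𝕜 E).toLinearMap
    (by exact (NormedSpace.inclusionInDoubleDualLi 𝕜).norm_map) Q hQ
  refine exists_isNormOneProjectionOnto_range i.toLinearMap (fun x => (i.norm_map x).le)
    (q.toLinearMap ∘ₗ p.toLinearMap ∘ₗ (NormedSpace.inclusionInDoubleDual 𝕜 Z).toLinearMap)
    (fun x => ?_) fun y => ?_
  · exact (congrArg q (hpi (NormedSpace.inclusionInDoubleDual 𝕜 E x))).trans (hqi x)
  · exact (hq _).trans ((hp _).trans (NormedSpace.double_dual_bound 𝕜 Z y))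

theorem universallyComplementedIn_iff_extensionPropertyIn [CompleteSpace E] :
    UniversallyComplementedIn 𝕜 X E ↔ ExtensionPropertyIn 𝕜 X E := by
  constructor
  · intro h Z _ _ _ hZ i W _ _ _ T
    obtain ⟨P, hP⟩ := h Z hZ i
    obtain ⟨p, hpi, hp⟩ := hP.exists_leftInverse i.toLinearMap i.norm_map
    have hpi' : ∀ x, p (i x) = x := hpi
    refine ⟨T.comp p, fun x => congrArg T (hpi x), le_antisymm ?_ ?_⟩
    · exact ContinuousLinearMap.opNorm_le_bound _ (norm_nonneg _) fun y =>
        T.le_of_opNorm_le_of_le le_rfl (hp y)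
    · refine ContinuousLinearMap.opNorm_le_bound _ (norm_nonneg _) fun x => ?_
      have h1 := (T.comp p).le_opNorm (i x)
      rwa [ContinuousLinearMap.comp_apply, hpi', i.norm_map] at h1
  · intro h Z _ _ _ hZ i
    -- Completeness of `E` makes it an admissible target.
    obtain ⟨p, hpi, hp⟩ := h Z hZ i E (ContinuousLinearMap.id 𝕜 E)
    refine exists_isNormOneProjectionOnto_range i.toLinearMap (fun x => (i.norm_map x).le)
      p.toLinearMap hpi fun y => ?_
    exact (p.le_of_opNorm_le (hp.le.trans ContinuousLinearMap.norm_id_le) y).trans_eq (one_mul _)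

end Complementation

theorem theorem3 {𝕜 : Type} [RCLike 𝕜]
    (X : Type u) [NormedAddCommGroup X] [NormedSpace 𝕜 X] [CompleteSpace X]
    (E : Type u) [NormedAddCommGroup E] [NormedSpace 𝕜 E] [CompleteSpace E] :
    (FinitelyRepresentable 𝕜 E X →
      (UniversallyComplementedIn 𝕜 X E ↔ AlgebraicallyClosedIn 𝕜 X E ∧ QuasiDual 𝕜 E)) ∧
    (UniversallyComplementedIn 𝕜 X E ↔ ExtensionPropertyIn 𝕜 X E) :=
  ⟨fun hE => ⟨fun h => ⟨h.algebraicallyClosedIn, h.quasiDual hE⟩,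
    fun h => h.1.universallyComplementedIn h.2⟩,
    universallyComplementedIn_iff_extensionPropertyIn⟩
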